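/- All algebras here are algebras $\mathbf A=\langle A,\lor,\land,{}^*,{}',0,1\rangle$ of type $(2,2,1,1,0,0)$ whose reduct $\langle A,\lor,\land,0,1\rangle$ is a bounded distributive lattice; homomorphisms preserve all the operations, embeddings are injective homomorphisms, a variety is a class closed under homomorphic images, subalgebras (up to isomorphism) and arbitrary direct products, and $\mathbb V(\mathbf S)$, $\mathbb V(\mathbf S,\mathbf T)$ denote the smallest varieties containing $\mathbf S$, respectively $\mathbf S$ and $\mathbf T$. Finite algebras. $\mathbf 2$ is the two-element Boolean algebra with $x^*=x'$ the complement of $x$. $\mathbf{3_{dblst}}$ is the chain $0<a<1$ with $0^*=1$, $a^*=1^*=0$ and $0'=a'=1$, $1'=0$. $\mathbf{3_{klst}}$ is the chain $0<a<1$ with $0^*=1$, $a^*=1^*=0$ and $0'=1$, $a'=a$, $1'=0$. $\mathbf{4_{dmba}}$ is the four-element Boolean lattice $\{0,a,b,1\}$ in which ${}^*$ is the Boolean complement and $0'=1$, $1'=0$, $a'=a$, $b'=b$. Consider the following conditions. (St) $\langle A,\lor,\land,{}^*,0,1\rangle$ is a Stone algebra: $0^*=1$, $1^*=0$, $(x\lor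 y)^*=x^*\land y^*$, $(x\land y)^{**}=x^{**}\land y^{**}$, $x\le x^{**}$, $x^*\land x^{**}=0$, $x^*\lor x^{**}=1$. (DQD) $\langle A,\lor,\land,{}',0,1\rangle$ is a dually quasi-De Morgan algebra: $0'=1$, $1'=0$, $(x\land y)'=x'\lor y'$, $(x\lor y)''=x''\lor y''$, $x''\le x$. (R1) $x\land x'{^*}'\le y\lor y^*$. The variety $\mathbb G$ of Gautama algebras is defined by (St), (DQD), (R1) and the identity $x{^*}'=x^{**}$. The variety $\mathbb{AG}$ of Almost Gautama algebras is defined by (St), (DQD), (R1) and the identities $x{^*}''=x^*$ and $(x\land x'^*)'^*=x\land x'^*$. An algebra $\mathbf A\in\mathbb V$ is injective in $\mathbb V$ if for all $\mathbf B,\mathbf C\in\mathbb V$, every embedding $f:\mathbf B\to\mathbf C$ and every homomorphism $g:\mathbf B\to\mathbf A$ there is a homomorphism $h:\mathbf C\to\mathbf A$ with $hf=g$. The variety $\mathbb V$ has enough injectives if every algebra in $\mathbb V$ can be embedded in an algebra that is injective in $\mathbb V$. Corollary. (a) Each of the four varieties $\mathbb V(\mathbf 2)$, $\mathbb V(\mathbf{3_{dblst}})$,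 $\mathbb V(\mathbf{3_{klst}})$, $\mathbb V(\mathbf{4_{dmba}})$ has enough injectives. (b) None of the four varieties $\mathbb G$, $\mathbb V(\mathbf{3_{dblst}},\mathbf{4_{dmba}})$, $\mathbb V(\mathbf{3_{klst}},\mathbf{4_{dmba}})$, $\mathbb{AG}$ has enough injectives. -/

import Mathlib

universe u v w

namespace AlmostGautama

/-- Algebras `⟨A, ∨, ∧, *, ', 0, 1⟩` whose reduct `⟨A, ∨, ∧, 0, 1⟩` is a bounded distributive
lattice (with `0 = ⊥`, `1 = ⊤`); `st` is the operation `*` and `pr` is the operation `'`, on which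
no conditions are imposed here. -/
class DLAlgebra (A : Type u) extends DistribLattice A, BoundedOrder A where
  /-- the operation `x ↦ x*` -/
  st : A → A
  /-- the operation `x ↦ x'` -/
  pr : A → A

open DLAlgebra

/-- Homomorphisms: maps preserving all of `∨, ∧, 0, 1, *, '`. -/
structure Hom (A : Type u) (B : Type v) [DLAlgebra A] [DLAlgebra B]
    extends BoundedLatticeHom A B where
  map_st' : ∀ x : A, toFun (st x) = st (toFun x)
  map_pr' : ∀ x : A, toFun (pr x) = pr (toFun x)

instance {A : Type u} {B : Type v} [DLAlgebra A] [DLAlgebra B] :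
    CoeFun (Hom A B) (fun _ => A → B) where
  coe f := f.toFun

/-- An embedding is an injective homomorphism. -/
def Hom.IsEmbedding {A : Type u} {B : Type v} [DLAlgebra A] [DLAlgebra B] (f : Hom A B) : Prop :=
  Function.Injective f

/-- Direct products, with coordinatewise operations. -/
instance instDLAlgebraPi {I : Type u} (A : I → Type v) [∀ i, DLAlgebra (A i)] :
    DLAlgebra (∀ i, A i) where
  st x := fun i => st (x i)
  pr x := fun i => pr (x i)

/-! ### The identities -/

/-- `⟨A, ∨, ∧, *, 0, 1⟩` is a Stone algebra. -/
structure IsStone (A : Type u) [DLAlgebra A] : Prop where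
  st_bot : st (⊥ : A) = ⊤
  st_top : st (⊤ : A) = ⊥
  st_sup : ∀ x y : A, st (x ⊔ y) = st x ⊓ st y
  st_st_inf : ∀ x y : A, st (st (x ⊓ y)) = st (st x) ⊓ st (st y)
  le_st_st : ∀ x : A, x ≤ st (st x)
  st_inf_st_st : ∀ x : A, st x ⊓ st (st x) = ⊥
  st_sup_st_st : ∀ x : A, st x ⊔ st (st x) = ⊤

/-- `⟨A, ∨, ∧, ', 0, 1⟩` is a dually quasi-De Morgan algebra. -/
structure IsDuallyQuasiDeMorgan (A : Type u) [DLAlgebra A] : Prop where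
  pr_bot : pr (⊥ : A) = ⊤
  pr_top : pr (⊤ : A) = ⊥
  pr_inf : ∀ x y : A, pr (x ⊓ y) = pr x ⊔ pr y
  pr_pr_sup : ∀ x y : A, pr (pr (x ⊔ y)) = pr (pr x) ⊔ pr (pr y)
  pr_pr_le : ∀ x : A, pr (pr x) ≤ x

/-- Regularity: `x ∧ x'*' ≤ y ∨ y*`. -/
def IsRegular (A : Type u) [DLAlgebra A] : Prop :=
  ∀ x y : A, x ⊓ pr (st (pr x)) ≤ y ⊔ st y

/-- Gautama algebras. -/
structure IsGautama (A : Type u) [DLAlgebra A] : Prop where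
  stone : IsStone A
  dqd : IsDuallyQuasiDeMorgan A
  regular : IsRegular A
  star_regular : ∀ x : A, pr (st x) = st (st x)

/-- Almost Gautama algebras. -/
structure IsAlmostGautama (A : Type u) [DLAlgebra A] : Prop where
  stone : IsStone A
  dqd : IsDuallyQuasiDeMorgan A
  regular : IsRegular A
  weak_star_regular : ∀ x : A, pr (pr (st x)) = st x
  l_one : ∀ x : A, st (pr (x ⊓ st (pr x))) = x ⊓ st (pr x)

/-! ### The finite algebras -/

/-- The two-element Boolean algebra; both `*` and `'` are complementation. -/
def Two : Type := Fin 2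

instance : DLAlgebra Two where
  toDistribLattice := inferInstanceAs (DistribLattice (Fin 2))
  toBoundedOrder := inferInstanceAs (BoundedOrder (Fin 2))
  st := (![1, 0] : Fin 2 → Fin 2)
  pr := (![1, 0] : Fin 2 → Fin 2)

/-- The three-element chain `0 < a < 1` with the pseudocomplement as `*` and the dual
pseudocomplement as `'`; its elements `0, a, 1` are here `0, 1, 2`. -/
def ThreeDblst : Type := Fin 3

instance : DLAlgebra ThreeDblst where
  toDistribLattice := inferInstanceAs (DistribLattice (Fin 3))
  toBoundedOrder := inferInstanceAs (BoundedOrder (Fin 3))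
  st := (![2, 0, 0] : Fin 3 → Fin 3)
  pr := (![2, 2, 0] : Fin 3 → Fin 3)

/-- The three-element chain `0 < a < 1` with the pseudocomplement as `*` and the De Morgan
(Kleene) involution as `'`; its elements `0, a, 1` are here `0, 1, 2`. -/
def ThreeKlst : Type := Fin 3

instance : DLAlgebra ThreeKlst where
  toDistribLattice := inferInstanceAs (DistribLattice (Fin 3))
  toBoundedOrder := inferInstanceAs (BoundedOrder (Fin 3))
  st := (![2, 0, 0] : Fin 3 → Fin 3)
  pr := (![2, 1, 0] : Fin 3 → Fin 3)

/-- The four-element Boolean lattice `{0, a, b, 1}`, where `*` is the Boolean complement, and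
`0' = 1`, `1' = 0`, `a' = a`, `b' = b`. Here `a = (true, false)` and `b = (false, true)`. -/
def FourDmba : Type := Bool × Bool

instance : DLAlgebra FourDmba where
  toDistribLattice := inferInstanceAs (DistribLattice (Bool × Bool))
  toBoundedOrder := inferInstanceAs (BoundedOrder (Bool × Bool))
  st := fun x : Bool × Bool => ((!x.1, !x.2) : Bool × Bool)
  pr := fun x : Bool × Bool => ((!x.2, !x.1) : Bool × Bool)

/-! ### Varieties -/

/-- Classes of algebras. -/
abbrev AlgClass : Type (u + 1) := (A : Type u) → [DLAlgebra A] → Prop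

/-- A variety is a class closed under homomorphic images, subalgebras (up to isomorphism: algebras
which embed in a member) and direct products (of arbitrary, possibly empty, families). -/
structure IsVariety (C : AlgClass.{u}) : Prop where
  image : ∀ (A B : Type u) [DLAlgebra A] [DLAlgebra B] (f : Hom A B),
    Function.Surjective f → C A → C B
  sub : ∀ (A B : Type u) [DLAlgebra A] [DLAlgebra B] (f : Hom A B),
    f.IsEmbedding → C B → C A
  prod : ∀ (I : Type u) (A : I → Type u) [∀ i, DLAlgebra (A i)],
    (∀ i, C (A i)) → C (∀ i, A i)

/-- `V(K)`, the smallest variety containing the class `K`. -/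
def varietyGenBy (K : AlgClass.{u}) : AlgClass.{u} := fun A _ =>
  ∀ C : AlgClass.{u}, IsVariety C → (∀ (B : Type u) [DLAlgebra B], K B → C B) → C A

/-- The class of all isomorphic copies (in `Type u`) of an algebra `S`. -/
def isoClass (S : Type v) [DLAlgebra S] : AlgClass.{u} := fun A _ =>
  ∃ f : Hom A S, Function.Bijective f

/-- `V(S)`, the variety generated by the algebra `S`. -/
def V (S : Type v) [DLAlgebra S] : AlgClass.{u} :=
  varietyGenBy (isoClass S)

/-- `V(S, T)`, the variety generated by the algebras `S` and `T`. -/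
def V₂ (S : Type v) (T : Type w) [DLAlgebra S] [DLAlgebra T] : AlgClass.{u} :=
  varietyGenBy (fun A _ => isoClass S A ∨ isoClass T A)

/-- The variety `G` of Gautama algebras. -/
def G : AlgClass.{u} := fun A _ => IsGautama A

/-- The variety `AG` of Almost Gautama algebras. -/
def AG : AlgClass.{u} := fun A _ => IsAlmostGautama A

/-! ### Enough injectives -/

/-- `A` is injective in `C`: `A` is a member of `C`, and every homomorphism `g : B → A` extends
along every embedding `f : B → D`, for all `B` and `D` in `C`. -/
def IsInjectiveIn (C : AlgClass.{u}) (A : Type u) [DLAlgebra A] : Prop :=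
  C A ∧ ∀ (B D : Type u) [DLAlgebra B] [DLAlgebra D], C B → C D →
    ∀ (f : Hom B D) (g : Hom B A), f.IsEmbedding → ∃ h : Hom D A, ∀ x : B, h (f x) = g x

/-- `C` has enough injectives: every member embeds in an algebra that is injective in `C`. -/
def HasEnoughInjectives (C : AlgClass.{u}) : Prop :=
  ∀ (A : Type u) [DLAlgebra A], C A →
    ∃ (J : Type u) (_ : DLAlgebra J), IsInjectiveIn C J ∧ ∃ f : Hom A J, f.IsEmbedding

end AlmostGautama

namespace AlmostGautama

open DLAlgebra Filter

/-! ### Homomorphisms -/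

section Homs

variable {A : Type u} {B : Type v} {D : Type w} [DLAlgebra A] [DLAlgebra B] [DLAlgebra D]

namespace Hom

/-! For (a), let `S` be one of the four finite algebras. The term `neq` takes the value `⊥` on equal
and `⊤` on distinct elements of `S`, so finite systems of equalities become single joins. Together
with compactness (ultralimits of homomorphisms into the finite `S`) this gives two things. First,
the algebras separated by homomorphisms into `S` are closed under quotients, hence form a variety
containing `V S` (`SepBy.image`). Second, if `B` embeds in a separated `D`, the kernel of any `g : B
→ S` is the restriction of the kernel of some `k : D → S` (`exists_extension_same_kernel`). An
endomorphism of `S` then turns `k` restricted to `B` into `g`. So powers of `S` are injective, and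
every member of `V S` embeds in one.

For (b), each variety contains `Two` and two extensions `S`, `T` of it that have no homomorphisms
into a common nontrivial member. If an injective `J` contained `S`, the map `Two → S → J` would
extend along `Two → T` to a map `T → J`, forcing `⊥ = ⊤` in `J`. The collapse is a computation with
one special element from each of `S` and `T`: regularity for `G`, the identity `l_one` applied to
their join in the other cases. -/

theorem map_sup (f : Hom A B) (x y : A) : f (x ⊔ y) = f x ⊔ f y := f.map_sup' x y
theorem map_inf (f : Hom A B) (x y : A) : f (x ⊓ y) = f x ⊓ f y := f.map_inf' x y
theorem map_bot (f : Hom A B) : f ⊥ = ⊥ := f.map_bot'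
theorem map_top (f : Hom A B) : f ⊤ = ⊤ := f.map_top'
theorem map_st (f : Hom A B) (x : A) : f (st x) = st (f x) := f.map_st' x
theorem map_pr (f : Hom A B) (x : A) : f (pr x) = pr (f x) := f.map_pr' x

theorem map_finset_sup (f : Hom A B) {ι : Type*} (F : Finset ι) (l : ι → A) :
    f (F.sup l) = F.sup fun i => f (l i) :=
  _root_.map_finset_sup f.toBoundedLatticeHom F l

/-- A homomorphism from a map that preserves all the operations. -/
def ofMap (f : A → B) (hs : ∀ x y, f (x ⊔ y) = f x ⊔ f y) (hi : ∀ x y, f (x ⊓ y) = f x ⊓ f y)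
    (hb : f ⊥ = ⊥) (ht : f ⊤ = ⊤) (hst : ∀ x, f (st x) = st (f x))
    (hpr : ∀ x, f (pr x) = pr (f x)) : Hom A B where
  toFun := f
  map_sup' := hs
  map_inf' := hi
  map_bot' := hb
  map_top' := ht
  map_st' := hst
  map_pr' := hpr

/-- Composition of homomorphisms. -/
def comp (g : Hom B D) (f : Hom A B) : Hom A D :=
  ofMap (fun x => g (f x)) (fun x y => by rw [f.map_sup, g.map_sup])
    (fun x y => by rw [f.map_inf, g.map_inf]) (by rw [f.map_bot, g.map_bot])
    (by rw [f.map_top, g.map_top]) (fun x => by rw [f.map_st, g.map_st])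
    (fun x => by rw [f.map_pr, g.map_pr])

/-- The identity homomorphism. -/
def refl (A : Type u) [DLAlgebra A] : Hom A A :=
  ofMap (fun x => x) (fun _ _ => rfl) (fun _ _ => rfl) rfl rfl (fun _ => rfl) (fun _ => rfl)

/-- A projection of a direct product. -/
def proj {I : Type w} (A : I → Type v) [∀ i, DLAlgebra (A i)] (i : I) : Hom (∀ i, A i) (A i) :=
  ofMap (fun x => x i) (fun _ _ => rfl) (fun _ _ => rfl) rfl rfl (fun _ => rfl) (fun _ => rfl)

/-- The homomorphism into a direct product with given coordinates. -/
def pi {I : Type w} {A : I → Type v} [∀ i, DLAlgebra (A i)] {B : Type u} [DLAlgebra B]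
    (f : ∀ i, Hom B (A i)) : Hom B (∀ i, A i) :=
  ofMap (fun x i => f i x) (fun x y => funext fun i => (f i).map_sup x y)
    (fun x y => funext fun i => (f i).map_inf x y) (funext fun i => (f i).map_bot)
    (funext fun i => (f i).map_top) (fun x => funext fun i => (f i).map_st x)
    (fun x => funext fun i => (f i).map_pr x)

/-- A homomorphism whose kernel contains that of a surjective homomorphism factors through it. -/
theorem exists_factor (f : Hom A B) (hf : Function.Surjective f) (k : Hom A D)
    (hk : ∀ x y, f x = f y → k x = k y) : ∃ h : Hom B D, ∀ x, h (f x) = k x := by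
  choose s hs using hf
  have key : ∀ x, k (s (f x)) = k x := fun x => hk _ _ (hs _)
  refine ⟨ofMap (fun y => k (s y)) (fun x y => ?_) (fun x y => ?_) ?_ ?_ (fun x => ?_)
    (fun x => ?_), key⟩
  · rw [← k.map_sup]; apply hk; rw [hs, f.map_sup, hs, hs]
  · rw [← k.map_inf]; apply hk; rw [hs, f.map_inf, hs, hs]
  · rw [← k.map_bot]; apply hk; rw [hs, f.map_bot]
  · rw [← k.map_top]; apply hk; rw [hs, f.map_top]
  · rw [← k.map_st]; apply hk; rw [hs, f.map_st, hs]
  · rw [← k.map_pr]; apply hk; rw [hs, f.map_pr, hs]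

end Hom

/-- The finite algebras live in `Type`, the classes in `Type u`; copies bridge the gap. -/
instance instDLAlgebraULift (S : Type v) [DLAlgebra S] : DLAlgebra (ULift.{u} S) where
  toDistribLattice := inferInstanceAs (DistribLattice (ULift.{u} S))
  toBoundedOrder := inferInstanceAs (BoundedOrder (ULift.{u} S))
  st x := ⟨st x.down⟩
  pr x := ⟨pr x.down⟩

/-- The isomorphism from the copy of an algebra in another universe. -/
def Hom.down (S : Type v) [DLAlgebra S] : Hom (ULift.{u} S) S :=
  Hom.ofMap ULift.down (fun _ _ => rfl) (fun _ _ => rfl) rfl rfl (fun _ => rfl) (fun _ => rfl)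

/-- The isomorphism to the copy of an algebra in another universe. -/
def Hom.up (S : Type v) [DLAlgebra S] : Hom S (ULift.{u} S) :=
  Hom.ofMap ULift.up (fun _ _ => rfl) (fun _ _ => rfl) rfl rfl (fun _ => rfl) (fun _ => rfl)

theorem isoClass_uLift (S : Type) [DLAlgebra S] : isoClass.{u} S (ULift.{u} S) :=
  ⟨Hom.down S, ULift.down_injective, fun x => ⟨⟨x⟩, rfl⟩⟩

end Homs

/-! ### Limits of homomorphisms into a finite algebra -/

/-- Finiteness of `S` gives every point a value along `U`. Each homomorphism law involves finitely
many points, so it is inherited from a single `h i`. -/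
theorem exists_ultralimit {A : Type u} {S : Type v} [DLAlgebra A] [DLAlgebra S] [Finite S]
    {ι : Type w} (h : ι → Hom A S) (U : Ultrafilter ι) :
    ∃ k : Hom A S, ∀ x, ∀ᶠ i in U, h i x = k x := by
  have hex : ∀ x, ∃ s, ∀ᶠ i in U, h i x = s := fun x => by
    obtain ⟨s, hs⟩ := Ultrafilter.eq_pure_of_finite (U.map fun i => h i x)
    refine ⟨s, ?_⟩
    have : {s} ∈ U.map fun i => h i x := by rw [hs]; exact rfl
    exact this
  choose k hk using hex
  refine ⟨Hom.ofMap k (fun x y => ?_) (fun x y => ?_) ?_ ?_ (fun x => ?_) (fun x => ?_), hk⟩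
  · obtain ⟨i, h1, h2, h3⟩ := ((hk (x ⊔ y)).and ((hk x).and (hk y))).exists
    rw [← h1, ← h2, ← h3, Hom.map_sup]
  · obtain ⟨i, h1, h2, h3⟩ := ((hk (x ⊓ y)).and ((hk x).and (hk y))).exists
    rw [← h1, ← h2, ← h3, Hom.map_inf]
  · obtain ⟨i, h1⟩ := (hk ⊥).exists
    rw [← h1, Hom.map_bot]
  · obtain ⟨i, h1⟩ := (hk ⊤).exists
    rw [← h1, Hom.map_top]
  · obtain ⟨i, h1, h2⟩ := ((hk (st x)).and (hk x)).exists
    rw [← h1, ← h2, Hom.map_st]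
  · obtain ⟨i, h1, h2⟩ := ((hk (pr x)).and (hk x)).exists
    rw [← h1, ← h2, Hom.map_pr]

/-- Compactness: a system of equalities that is finitely satisfiable by homomorphisms which
separate `a` from `b` is satisfiable by one. -/
theorem exists_hom_of_finitely_satisfiable {A : Type u} {S : Type v} [DLAlgebra A] [DLAlgebra S]
    [Finite S] {ι : Type w} (l r : ι → A) (a b : A)
    (H : ∀ F : Finset ι, ∃ h : Hom A S, (∀ i ∈ F, h (l i) = h (r i)) ∧ h a ≠ h b) :
    ∃ k : Hom A S, (∀ i, k (l i) = k (r i)) ∧ k a ≠ k b := by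
  classical
  choose h hF hab using H
  -- The ultrafilter refines `atTop` on finite sets of equations, so each equation belongs to almost
  -- every `F`.
  obtain ⟨k, hk⟩ := exists_ultralimit h (Ultrafilter.of atTop)
  refine ⟨k, fun i => ?_, ?_⟩
  · have hi : ∀ᶠ F in ((Ultrafilter.of atTop : Ultrafilter (Finset ι)) : Filter (Finset ι)),
        i ∈ F :=
      Ultrafilter.of_le atTop
        ((eventually_ge_atTop ({i} : Finset ι)).mono fun F hF => hF (Finset.mem_singleton_self i))
    obtain ⟨F, h1, h2, h3⟩ := (hi.and ((hk (l i)).and (hk (r i)))).exists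
    rw [← h2, ← h3, hF F i h1]
  · obtain ⟨F, h1, h2⟩ := ((hk a).and (hk b)).exists
    rw [← h1, ← h2]
    exact hab F

/-! ### The inequality term -/

/-- On the four finite algebras, the characteristic function of `1`. -/
def delta {A : Type u} [DLAlgebra A] (x : A) : A := x ⊓ st (pr x)

/-- On the four finite algebras, the characteristic function of inequality. -/
def neq {A : Type u} [DLAlgebra A] (x y : A) : A :=
  st (delta (((st x ⊔ st (st y)) ⊓ (st y ⊔ st (st x))) ⊓
    ((delta x ⊔ st (delta y)) ⊓ (delta y ⊔ st (delta x)))))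

theorem Hom.map_neq {A : Type u} {B : Type v} [DLAlgebra A] [DLAlgebra B] (f : Hom A B) (x y : A) :
    f (neq x y) = neq (f x) (f y) := by
  simp only [neq, delta, Hom.map_sup, Hom.map_inf, Hom.map_st, Hom.map_pr]

/-- Nontrivial algebras on which `neq` is the characteristic function of inequality. -/
structure NeqDetects (S : Type u) [DLAlgebra S] : Prop where
  bot_ne_top : (⊥ : S) ≠ ⊤
  neq_self : ∀ x : S, neq x x = ⊥
  neq_of_ne : ∀ x y : S, x ≠ y → neq x y = ⊤

theorem NeqDetects.map_sup_neq_eq_top {S : Type v} [DLAlgebra S] (hS : NeqDetects S) {A : Type u}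
    [DLAlgebra A] (h : Hom A S) {ι : Type w} (l r : ι → A) (F : Finset ι)
    (H : ∃ i ∈ F, h (l i) ≠ h (r i)) : h (F.sup fun i => neq (l i) (r i)) = ⊤ := by
  obtain ⟨i, hi, hne⟩ := H
  rw [h.map_finset_sup, eq_top_iff, ← hS.neq_of_ne _ _ hne, ← h.map_neq]
  exact Finset.le_sup (f := fun i => h (neq (l i) (r i))) hi

theorem NeqDetects.map_sup_neq_eq_bot {S : Type v} [DLAlgebra S] (hS : NeqDetects S) {A : Type u}
    [DLAlgebra A] (h : Hom A S) {ι : Type w} (l r : ι → A) (F : Finset ι)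
    (H : ∀ i, h (l i) = h (r i)) : h (F.sup fun i => neq (l i) (r i)) = ⊥ := by
  rw [h.map_finset_sup, Finset.sup_eq_bot_iff]
  intro i _
  rw [h.map_neq, H, hS.neq_self]

/-- The algebras whose points are separated by homomorphisms into `S`. -/
def SepBy (S : Type v) [DLAlgebra S] : AlgClass.{u} := fun A _ =>
  ∀ x y : A, x ≠ y → ∃ h : Hom A S, h x ≠ h y

theorem SepBy.eq {S : Type v} [DLAlgebra S] {A : Type u} [DLAlgebra A] (hA : SepBy S A) {x y : A}
    (h : ∀ f : Hom A S, f x = f y) : x = y := by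
  by_contra hne
  obtain ⟨f, hf⟩ := hA x y hne
  exact hf (h f)

/-- To separate `f a` from `f b`, a homomorphism `A → S` is sought that separates `a` from `b` and
kills the kernel of `f`; it then factors through `f`. -/
theorem SepBy.image {S : Type w} [DLAlgebra S] [Finite S] (hS : NeqDetects S)
    {A : Type u} {B : Type v} [DLAlgebra A] [DLAlgebra B] (f : Hom A B)
    (hf : Function.Surjective f) (hA : SepBy S A) : SepBy S B := by
  intro x y hxy
  obtain ⟨a, rfl⟩ := hf x
  obtain ⟨b, rfl⟩ := hf y
  have neq_self : ∀ a : A, neq a a = ⊥ := fun a =>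
    hA.eq fun h => by rw [h.map_neq, h.map_bot, hS.neq_self]
  obtain ⟨k, hk, hkab⟩ := exists_hom_of_finitely_satisfiable (S := S)
    (fun p : {p : A × A // f p.1 = f p.2} => p.1.1) (fun p => p.1.2) a b (by
      intro F
      by_contra! H
      -- If `F` fails, every homomorphism separating `a` from `b` separates some pair in `F`, so
      -- `neq a b` lies below the join over `F`, which `f` sends to `⊥`.
      have hle : neq a b ⊓ (F.sup fun p => neq p.1.1 p.1.2) = neq a b := hA.eq fun h => by
        rw [h.map_inf, inf_eq_left, h.map_neq]
        by_cases hab : h a = h b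
        · rw [hab, hS.neq_self]
          exact bot_le
        · rw [hS.map_sup_neq_eq_top h _ _ F (by by_contra! hF; exact hab (H h hF))]
          exact le_top
      have hbot : f (F.sup fun p => neq p.1.1 p.1.2) = ⊥ := by
        rw [f.map_finset_sup, Finset.sup_eq_bot_iff]
        rintro ⟨p, hp⟩ -
        rw [f.map_neq, ← hp, ← f.map_neq, neq_self, f.map_bot]
      have hneq : f (neq a b) = ⊥ := by
        rw [← hle, f.map_inf, hbot, inf_bot_eq]
      -- This identity turns `f (neq a b) = ⊥` into `f a = f b`.
      have hid : a ⊔ neq a b = b ⊔ neq a b := hA.eq fun h => by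
        rw [h.map_sup, h.map_sup, h.map_neq]
        by_cases hab : h a = h b
        · rw [hab]
        · rw [hS.neq_of_ne _ _ hab, sup_top_eq, sup_top_eq]
      apply hxy
      have := congrArg f hid
      rwa [f.map_sup, f.map_sup, hneq, sup_bot_eq, sup_bot_eq] at this)
  obtain ⟨h, hh⟩ := f.exists_factor hf k fun x y hxy => hk ⟨(x, y), hxy⟩
  exact ⟨h, by rwa [hh, hh]⟩

theorem SepBy.sub {S : Type w} [DLAlgebra S] {A : Type u} {B : Type v} [DLAlgebra A] [DLAlgebra B]
    (f : Hom A B) (hf : f.IsEmbedding) (hB : SepBy S B) : SepBy S A := fun x y hxy => by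
  obtain ⟨h, hh⟩ := hB (f x) (f y) (hf.ne hxy)
  exact ⟨h.comp f, hh⟩

theorem isVariety_sepBy {S : Type v} [DLAlgebra S] [Finite S] (hS : NeqDetects S) :
    IsVariety (SepBy.{u} S) where
  image _ _ _ _ f hf hA := hA.image hS f hf
  sub _ _ _ _ f hf hB := hB.sub f hf
  prod I A _ hA x y hxy := by
    obtain ⟨i, hi⟩ := Function.ne_iff.1 hxy
    obtain ⟨h, hh⟩ := hA i _ _ hi
    exact ⟨h.comp (Hom.proj A i), hh⟩

theorem sepBy_of_V {S : Type v} [DLAlgebra S] [Finite S] (hS : NeqDetects S) {A : Type u}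
    [DLAlgebra A] (hA : V S A) : SepBy S A :=
  hA (SepBy S) (isVariety_sepBy hS) fun _ _ ⟨f, hf⟩ _ _ hxy => ⟨f, hf.1.ne hxy⟩

/-! ### Enough injectives -/

theorem exists_extension_same_kernel {S : Type w} [DLAlgebra S] [Finite S] (hS : NeqDetects S)
    {B : Type u} {D : Type v} [DLAlgebra B] [DLAlgebra D] (hD : SepBy S D)
    (f : Hom B D) (hf : f.IsEmbedding) (g : Hom B S) :
    ∃ k : Hom D S, ∀ x y, g x = g y ↔ k (f x) = k (f y) := by
  obtain ⟨k, hk, -⟩ := exists_hom_of_finitely_satisfiable (S := S)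
    (fun p : {p : B × B // g p.1 = g p.2} => f p.1.1) (fun p => f p.1.2) ⊥ ⊤ (by
      intro F
      by_contra! H
      -- With the pair `⊥`, `⊤` the separation requirement is vacuous. If no homomorphism from `D`
      -- satisfies `F`, the join is `⊤` in `D`, hence in `B`; but `g` sends it to `⊥`.
      have htop : (F.sup fun p => neq p.1.1 p.1.2) = ⊤ := hf <| by
        refine hD.eq fun h => ?_
        have := hS.map_sup_neq_eq_top (h.comp f) (fun p => p.1.1) (fun p => p.1.2) F (by
          by_contra! hF
          have := H h hF
          rw [h.map_bot, h.map_top] at this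
          exact hS.bot_ne_top this)
        exact this.trans (h.comp f).map_top.symm
      apply hS.bot_ne_top
      rw [← g.map_top, ← htop, hS.map_sup_neq_eq_bot g _ _ F Subtype.property])
  refine ⟨k, fun x y => ⟨fun h => hk ⟨(x, y), h⟩, fun h => ?_⟩⟩
  by_contra hne
  -- A disequality under `g` is itself an equality in the kernel of `g`, so `k` preserves it.
  have h1 : g (neq x y) = g ⊤ := by rw [g.map_neq, hS.neq_of_ne _ _ hne, g.map_top]
  have h2 : k (f (neq x y)) = k (f ⊤) := hk ⟨(_, _), h1⟩
  rw [f.map_neq, k.map_neq, h, hS.neq_self, f.map_top, k.map_top] at h2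
  exact hS.bot_ne_top h2

/-- Homomorphisms into `S` with the same kernel differ by an endomorphism of `S`. -/
def KernelHomogeneous (S : Type v) [DLAlgebra S] : Prop :=
  ∀ (B : Type u) [DLAlgebra B] (g k : Hom B S), (∀ x y, g x = g y ↔ k x = k y) →
    ∃ s : Hom S S, ∀ x, s (k x) = g x

theorem varietyGenBy_of_mem {K : AlgClass.{u}} {A : Type u} [DLAlgebra A] (hA : K A) :
    varietyGenBy K A := fun _ _ h => h A hA

theorem hasEnoughInjectives_V {S : Type} [DLAlgebra S] [Finite S] (hS : NeqDetects S)
    (hom : KernelHomogeneous.{u} S) : HasEnoughInjectives (V.{u} S) := by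
  intro A _ hA
  refine ⟨Hom A S → ULift.{u} S, inferInstance, ⟨?_, ?_⟩, ?_⟩
  · exact fun C hC hK => hC.prod _ _ fun _ => hK _ (isoClass_uLift S)
  · intro B D _ _ _ hD f g hf
    have : ∀ i : Hom A S, ∃ h : Hom D S, ∀ x, h (f x) = (g x i).down := fun i => by
      obtain ⟨k, hk⟩ := exists_extension_same_kernel hS (sepBy_of_V hS hD) f hf
        ((Hom.down S).comp ((Hom.proj _ i).comp g))
      obtain ⟨s, hs⟩ := hom B _ (k.comp f) hk
      exact ⟨s.comp k, hs⟩
    choose h hh using this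
    exact ⟨Hom.pi fun i => (Hom.up S).comp (h i),
      fun x => funext fun i => ULift.down_injective (hh i x)⟩
  · refine ⟨Hom.pi fun i => (Hom.up S).comp i, fun x y hxy => ?_⟩
    exact (sepBy_of_V hS hA).eq fun i => congrArg ULift.down (congrFun hxy i)

/-! ### The finite algebras -/

instance : Fintype Two := inferInstanceAs (Fintype (Fin 2))
instance : DecidableEq Two := inferInstanceAs (DecidableEq (Fin 2))
instance : Fintype ThreeDblst := inferInstanceAs (Fintype (Fin 3))
instance : DecidableEq ThreeDblst := inferInstanceAs (DecidableEq (Fin 3))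
instance : Fintype ThreeKlst := inferInstanceAs (Fintype (Fin 3))
instance : DecidableEq ThreeKlst := inferInstanceAs (DecidableEq (Fin 3))
instance : Fintype FourDmba := inferInstanceAs (Fintype (Bool × Bool))
instance : DecidableEq FourDmba := inferInstanceAs (DecidableEq (Bool × Bool))

/-- Lets `decide` check the inequalities among the axioms. -/
instance {A : Type u} [DLAlgebra A] [DecidableEq A] : DecidableLE A :=
  fun _ _ => decidable_of_iff _ inf_eq_left

theorem neqDetects_two : NeqDetects Two := ⟨by decide, by decide, by decide⟩
theorem neqDetects_threeDblst : NeqDetects ThreeDblst := ⟨by decide, by decide, by decide⟩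
theorem neqDetects_threeKlst : NeqDetects ThreeKlst := ⟨by decide, by decide, by decide⟩
theorem neqDetects_fourDmba : NeqDetects FourDmba := ⟨by decide, by decide, by decide⟩

/-- An algebra with at most one element besides `0` and `1` is kernel homogeneous. -/
theorem kernelHomogeneous_of_small {S : Type v} [DLAlgebra S]
    (h : ∀ s t : S, (s = ⊥ ↔ t = ⊥) → (s = ⊤ ↔ t = ⊤) → t = s) : KernelHomogeneous.{u} S := by
  intro B _ g k hgk
  refine ⟨Hom.refl S, fun x => h _ _ ?_ ?_⟩
  · have := hgk x ⊥
    rwa [g.map_bot, k.map_bot] at this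
  · have := hgk x ⊤
    rwa [g.map_top, k.map_top] at this

/-- The automorphism of `FourDmba` that exchanges the two atoms. -/
def FourDmba.swap : Hom FourDmba FourDmba :=
  Hom.ofMap (fun x : FourDmba => st (pr x)) (by decide) (by decide) (by decide)
    (by decide) (by decide) (by decide)

theorem kernelHomogeneous_fourDmba : KernelHomogeneous.{u} FourDmba := by
  intro B _ g k hgk
  have hbot : ∀ x, g x = ⊥ ↔ k x = ⊥ := fun x => by
    have := hgk x ⊥
    rwa [g.map_bot, k.map_bot] at this
  have htop : ∀ x, g x = ⊤ ↔ k x = ⊤ := fun x => by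
    have := hgk x ⊤
    rwa [g.map_top, k.map_top] at this
  by_cases H : ∀ x, k x = g x
  · exact ⟨Hom.refl _, H⟩
  · push Not at H
    obtain ⟨x, hx⟩ := H
    refine ⟨FourDmba.swap, fun y => ?_⟩
    -- Where `g` and `k` differ, their values are the two different atoms; the common kernel then
    -- forces the swap at every other point.
    have key : ∀ s t s' t' : FourDmba, (s = ⊥ ↔ t = ⊥) → (s = ⊤ ↔ t = ⊤) → t ≠ s →
        (s' = ⊥ ↔ t' = ⊥) → (s' = ⊤ ↔ t' = ⊤) → (s = s' ↔ t = t') →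
        FourDmba.swap t' = s' := by decide
    exact key _ _ _ _ (hbot x) (htop x) hx (hbot y) (htop y) (hgk x y)

/-! ### Identities -/

section Identities

variable {A : Type u} [DLAlgebra A]

theorem le_of_separating {I : Type w} {B : I → Type v} [∀ i, DLAlgebra (B i)]
    (f : ∀ i, Hom A (B i)) (sep : ∀ x y, (∀ i, f i x = f i y) → x = y) {x y : A}
    (h : ∀ i, f i x ≤ f i y) : x ≤ y :=
  inf_eq_left.1 (sep _ _ fun i => by rw [(f i).map_inf, inf_eq_left.2 (h i)])

theorem IsStone.of_separating {I : Type w} {B : I → Type v} [∀ i, DLAlgebra (B i)]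
    (f : ∀ i, Hom A (B i)) (sep : ∀ x y, (∀ i, f i x = f i y) → x = y)
    (h : ∀ i, IsStone (B i)) : IsStone A where
  st_bot := sep _ _ fun i => by
    simp only [Hom.map_st, Hom.map_bot, Hom.map_top, (h i).st_bot]
  st_top := sep _ _ fun i => by
    simp only [Hom.map_st, Hom.map_bot, Hom.map_top, (h i).st_top]
  st_sup x y := sep _ _ fun i => by
    simp only [Hom.map_st, Hom.map_sup, Hom.map_inf, (h i).st_sup]
  st_st_inf x y := sep _ _ fun i => by
    simp only [Hom.map_st, Hom.map_inf, (h i).st_st_inf]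
  le_st_st x := le_of_separating f sep fun i => by
    simp only [Hom.map_st, (h i).le_st_st]
  st_inf_st_st x := sep _ _ fun i => by
    simp only [Hom.map_st, Hom.map_inf, Hom.map_bot, (h i).st_inf_st_st]
  st_sup_st_st x := sep _ _ fun i => by
    simp only [Hom.map_st, Hom.map_sup, Hom.map_top, (h i).st_sup_st_st]

theorem IsDuallyQuasiDeMorgan.of_separating {I : Type w} {B : I → Type v} [∀ i, DLAlgebra (B i)]
    (f : ∀ i, Hom A (B i)) (sep : ∀ x y, (∀ i, f i x = f i y) → x = y)
    (h : ∀ i, IsDuallyQuasiDeMorgan (B i)) : IsDuallyQuasiDeMorgan A where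
  pr_bot := sep _ _ fun i => by
    simp only [Hom.map_pr, Hom.map_bot, Hom.map_top, (h i).pr_bot]
  pr_top := sep _ _ fun i => by
    simp only [Hom.map_pr, Hom.map_bot, Hom.map_top, (h i).pr_top]
  pr_inf x y := sep _ _ fun i => by
    simp only [Hom.map_pr, Hom.map_sup, Hom.map_inf, (h i).pr_inf]
  pr_pr_sup x y := sep _ _ fun i => by
    simp only [Hom.map_pr, Hom.map_sup, (h i).pr_pr_sup]
  pr_pr_le x := le_of_separating f sep fun i => by
    simp only [Hom.map_pr, (h i).pr_pr_le]

theorem IsRegular.of_separating {I : Type w} {B : I → Type v} [∀ i, DLAlgebra (B i)]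
    (f : ∀ i, Hom A (B i)) (sep : ∀ x y, (∀ i, f i x = f i y) → x = y)
    (h : ∀ i, IsRegular (B i)) : IsRegular A := fun x y =>
  le_of_separating f sep fun i => by
    simp only [Hom.map_st, Hom.map_pr, Hom.map_sup, Hom.map_inf, h i _ _]

theorem IsAlmostGautama.of_separating {I : Type w} {B : I → Type v} [∀ i, DLAlgebra (B i)]
    (f : ∀ i, Hom A (B i)) (sep : ∀ x y, (∀ i, f i x = f i y) → x = y)
    (h : ∀ i, IsAlmostGautama (B i)) : IsAlmostGautama A where
  stone := .of_separating f sep fun i => (h i).stone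
  dqd := .of_separating f sep fun i => (h i).dqd
  regular := .of_separating f sep fun i => (h i).regular
  weak_star_regular x := sep _ _ fun i => by
    simp only [Hom.map_st, Hom.map_pr, (h i).weak_star_regular]
  l_one x := sep _ _ fun i => by
    simp only [Hom.map_st, Hom.map_pr, Hom.map_inf, (h i).l_one]

theorem IsGautama.of_isEmbedding {B : Type v} [DLAlgebra B] (f : Hom A B) (hf : f.IsEmbedding)
    (h : IsGautama B) : IsGautama A where
  stone := .of_separating (fun _ : Unit => f) (fun _ _ e => hf (e ())) fun _ => h.stone
  dqd := .of_separating (fun _ : Unit => f) (fun _ _ e => hf (e ())) fun _ => h.dqd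
  regular := .of_separating (fun _ : Unit => f) (fun _ _ e => hf (e ())) fun _ => h.regular
  star_regular x := hf <| by
    simp only [Hom.map_st, Hom.map_pr, h.star_regular]

theorem IsAlmostGautama.of_isEmbedding {B : Type v} [DLAlgebra B] (f : Hom A B)
    (hf : f.IsEmbedding) (h : IsAlmostGautama B) : IsAlmostGautama A :=
  .of_separating (fun _ : Unit => f) (fun _ _ e => hf (e ())) fun _ => h

theorem IsAlmostGautama.image {B : Type v} [DLAlgebra B] (f : Hom A B)
    (hf : Function.Surjective f) (h : IsAlmostGautama A) : IsAlmostGautama B := by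
  have mono : ∀ {x y : A}, x ≤ y → f x ≤ f y := fun {x y} hxy => by
    rw [← inf_eq_left, ← f.map_inf, inf_eq_left.2 hxy]
  refine ⟨⟨?_, ?_, ?_, ?_, ?_, ?_, ?_⟩, ⟨?_, ?_, ?_, ?_, ?_⟩, ?_, ?_, ?_⟩
  · rw [← f.map_bot, ← f.map_st, h.stone.st_bot, f.map_top]
  · rw [← f.map_top, ← f.map_st, h.stone.st_top, f.map_bot]
  · refine hf.forall₂.2 fun x y => ?_
    simpa only [Hom.map_st, Hom.map_sup, Hom.map_inf] using congrArg f (h.stone.st_sup x y)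
  · refine hf.forall₂.2 fun x y => ?_
    simpa only [Hom.map_st, Hom.map_inf] using congrArg f (h.stone.st_st_inf x y)
  · refine hf.forall.2 fun x => ?_
    simpa only [Hom.map_st] using mono (h.stone.le_st_st x)
  · refine hf.forall.2 fun x => ?_
    simpa only [Hom.map_st, Hom.map_inf, Hom.map_bot] using congrArg f (h.stone.st_inf_st_st x)
  · refine hf.forall.2 fun x => ?_
    simpa only [Hom.map_st, Hom.map_sup, Hom.map_top] using congrArg f (h.stone.st_sup_st_st x)
  · rw [← f.map_bot, ← f.map_pr, h.dqd.pr_bot, f.map_top]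
  · rw [← f.map_top, ← f.map_pr, h.dqd.pr_top, f.map_bot]
  · refine hf.forall₂.2 fun x y => ?_
    simpa only [Hom.map_pr, Hom.map_sup, Hom.map_inf] using congrArg f (h.dqd.pr_inf x y)
  · refine hf.forall₂.2 fun x y => ?_
    simpa only [Hom.map_pr, Hom.map_sup] using congrArg f (h.dqd.pr_pr_sup x y)
  · refine hf.forall.2 fun x => ?_
    simpa only [Hom.map_pr] using mono (h.dqd.pr_pr_le x)
  · refine hf.forall₂.2 fun x y => ?_
    simpa only [Hom.map_st, Hom.map_pr, Hom.map_sup, Hom.map_inf] using mono (h.regular x y)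
  · refine hf.forall.2 fun x => ?_
    simpa only [Hom.map_st, Hom.map_pr] using congrArg f (h.weak_star_regular x)
  · refine hf.forall.2 fun x => ?_
    simpa only [Hom.map_st, Hom.map_pr, Hom.map_inf] using congrArg f (h.l_one x)

end Identities

/-! ### Varieties given by identities, and the finite algebras in them -/

theorem isVariety_AG : IsVariety AG.{u} where
  image _ _ _ _ f hf h := IsAlmostGautama.image f hf h
  sub _ _ _ _ f hf h := IsAlmostGautama.of_isEmbedding f hf h
  prod _ A _ h := IsAlmostGautama.of_separating (Hom.proj A) (fun _ _ => funext) h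

/-- The Almost Gautama algebras in which `'` is an involution. -/
def InvolutiveAG : AlgClass.{u} := fun A _ => IsAlmostGautama A ∧ ∀ x : A, pr (pr x) = x

theorem isVariety_involutiveAG : IsVariety InvolutiveAG.{u} where
  image _ _ _ _ f hf h := ⟨h.1.image f hf, hf.forall.2 fun x => by
    rw [← f.map_pr, ← f.map_pr, h.2]⟩
  sub _ _ _ _ f hf h := ⟨h.1.of_isEmbedding f hf, fun x => hf <| by
    rw [f.map_pr, f.map_pr, h.2]⟩
  prod _ _ _ h := ⟨isVariety_AG.prod _ _ fun i => (h i).1, fun x => funext fun i => (h i).2 (x i)⟩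

theorem isGautama_two : IsGautama Two :=
  ⟨by constructor <;> decide, by constructor <;> decide, by unfold IsRegular; decide, by decide⟩
theorem isGautama_threeDblst : IsGautama ThreeDblst :=
  ⟨by constructor <;> decide, by constructor <;> decide, by unfold IsRegular; decide, by decide⟩
theorem isGautama_threeKlst : IsGautama ThreeKlst :=
  ⟨by constructor <;> decide, by constructor <;> decide, by unfold IsRegular; decide, by decide⟩
theorem isAlmostGautama_threeDblst : IsAlmostGautama ThreeDblst :=
  ⟨isGautama_threeDblst.stone, isGautama_threeDblst.dqd, isGautama_threeDblst.regular,
    by decide, by decide⟩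
theorem isAlmostGautama_threeKlst : IsAlmostGautama ThreeKlst :=
  ⟨isGautama_threeKlst.stone, isGautama_threeKlst.dqd, isGautama_threeKlst.regular,
    by decide, by decide⟩
theorem isAlmostGautama_fourDmba : IsAlmostGautama FourDmba :=
  ⟨by constructor <;> decide, by constructor <;> decide, by unfold IsRegular; decide, by decide,
    by decide⟩

theorem AG_of_V₂_threeDblst_fourDmba {A : Type u} [DLAlgebra A]
    (hA : V₂ ThreeDblst FourDmba A) : IsAlmostGautama A := by
  refine hA AG isVariety_AG fun B _ hB => ?_
  obtain ⟨f, hf⟩ | ⟨f, hf⟩ := hB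
  · exact isAlmostGautama_threeDblst.of_isEmbedding f hf.1
  · exact isAlmostGautama_fourDmba.of_isEmbedding f hf.1

/-- The collapse for this pair uses `x'' = x`, which holds in both generators but fails in
`ThreeDblst`. -/
theorem involutiveAG_of_V₂_threeKlst_fourDmba {A : Type u} [DLAlgebra A]
    (hA : V₂ ThreeKlst FourDmba A) : InvolutiveAG A := by
  refine hA InvolutiveAG isVariety_involutiveAG fun B _ hB => ?_
  obtain ⟨f, hf⟩ | ⟨f, hf⟩ := hB
  · refine ⟨isAlmostGautama_threeKlst.of_isEmbedding f hf.1, fun x => hf.1 ?_⟩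
    rw [f.map_pr, f.map_pr]
    exact (by decide : ∀ x : ThreeKlst, pr (pr x) = x) _
  · refine ⟨isAlmostGautama_fourDmba.of_isEmbedding f hf.1, fun x => hf.1 ?_⟩
    rw [f.map_pr, f.map_pr]
    exact (by decide : ∀ x : FourDmba, pr (pr x) = x) _

/-! ### Algebras that generate no common extension -/

section Collapse

variable {A : Type u} [DLAlgebra A]

theorem IsStone.st_anti (h : IsStone A) {x y : A} (hxy : x ≤ y) : st y ≤ st x := by
  rw [← sup_eq_right.2 hxy, h.st_sup]
  exact inf_le_left

theorem IsStone.st_st_st (h : IsStone A) (x : A) : st (st (st x)) = st x :=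
  le_antisymm (h.st_anti (h.le_st_st x)) (h.le_st_st _)

theorem IsDuallyQuasiDeMorgan.pr_anti (h : IsDuallyQuasiDeMorgan A) {x y : A} (hxy : x ≤ y) :
    pr y ≤ pr x := by
  rw [← inf_eq_left.2 hxy, h.pr_inf]
  exact le_sup_right

theorem IsAlmostGautama.sup_inf_st (h : IsAlmostGautama A) (e : A) {c : A} (hc : st (st c) = c) :
    (e ⊔ c) ⊓ st c = e ⊓ st c := by
  have := h.stone.st_inf_st_st c
  rw [hc, inf_comm] at this
  rw [inf_sup_right, this, sup_bot_eq]

/-- As `e` is dense, `e ∧ c* = 0` gives `c* = 0`, so `c = 1`, contrary to `c' = c` unless the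
algebra is trivial. -/
theorem IsAlmostGautama.bot_eq_top_of_inf_st_eq_bot (h : IsAlmostGautama A) {e c : A}
    (he : st e = ⊥) (hc : st (st c) = c) (hc' : pr c = c) (hec : e ⊓ st c = ⊥) :
    (⊥ : A) = ⊤ := by
  have h1 := h.stone.st_st_inf e (st c)
  rw [hec, he, h.stone.st_bot, h.stone.st_top, hc, top_inf_eq] at h1
  rw [← h1, h.stone.st_bot] at hc
  rw [← hc, h.dqd.pr_top, hc] at hc'
  exact hc'.trans hc.symm

theorem IsAlmostGautama.bot_eq_top_of_dense_of_fixed (h : IsAlmostGautama A) {e c : A}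
    (he : st e = ⊥) (he' : pr e = ⊤) (hc : st (st c) = c) (hc' : pr c = c) :
    (⊥ : A) = ⊤ := by
  have h1 : pr (pr (e ⊔ c)) = c := by
    rw [h.dqd.pr_pr_sup, he', h.dqd.pr_top, hc', hc', bot_sup_eq]
  have h2 : pr (e ⊔ c) = c := by
    apply le_antisymm
    · exact (h.dqd.pr_anti le_sup_right).trans hc'.le
    · have := h.dqd.pr_pr_le (pr (e ⊔ c))
      rwa [h1, hc'] at this
  -- Since `(e ∨ c)' = c`, the element `x ∧ x'*` for `x = e ∨ c` is `e ∧ c*`. Its image under `'*`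
  -- is `⊥` because `e' = 1`, so `l_one` gives `e ∧ c* = 0`.
  have h3 := h.l_one (e ⊔ c)
  rw [h2, h.sup_inf_st e hc, h.dqd.pr_inf, he', top_sup_eq, h.stone.st_top] at h3
  exact h.bot_eq_top_of_inf_st_eq_bot he hc hc' h3.symm

theorem IsAlmostGautama.bot_eq_top_of_involutive (h : IsAlmostGautama A)
    (inv : ∀ x : A, pr (pr x) = x) {e c : A}
    (he : st e = ⊥) (he' : pr e = e) (hc : st (st c) = c) (hc' : pr c = c) :
    (⊥ : A) = ⊤ := by
  have h1 : pr (e ⊔ c) = e ⊓ c := by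
    rw [← inv (e ⊓ c), h.dqd.pr_inf, he', hc']
  have h2 : st (e ⊓ c) = st c := by
    rw [← h.stone.st_st_st, h.stone.st_st_inf, he, h.stone.st_bot, hc, top_inf_eq]
  -- Again `x ∧ x'*` is `e ∧ c*`; now `'*` sends it to `⊥` because `e' = e` and `e* = 0`.
  have h3 := h.l_one (e ⊔ c)
  rw [h1, h2, h.sup_inf_st e hc, h.dqd.pr_inf, he', h.stone.st_sup, he, bot_inf_eq] at h3
  exact h.bot_eq_top_of_inf_st_eq_bot he hc hc' h3.symm

/-- Regularity at `k`, `e` reduces to `k ≤ e`; applying `'` gives `1 ≤ k' = k`, whence `1 = 1' = 0`.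
-/
theorem IsGautama.bot_eq_top_of_dense_of_fixed (h : IsGautama A) {e k : A}
    (he : st e = ⊥) (he' : pr e = ⊤) (hk : st k = ⊥) (hk' : pr k = k) : (⊥ : A) = ⊤ := by
  have h1 := h.regular k e
  rw [hk', hk, he, h.dqd.pr_bot, inf_top_eq, sup_bot_eq] at h1
  have h2 := h.dqd.pr_anti h1
  rw [he', hk', top_le_iff] at h2
  rw [← h2, ← hk', h2, h.dqd.pr_top]

end Collapse

theorem ThreeDblst.exists_middle {A : Type u} [DLAlgebra A] (f : Hom ThreeDblst A) :
    ∃ e : A, st e = ⊥ ∧ pr e = ⊤ := by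
  obtain ⟨e, he, he'⟩ : ∃ e : ThreeDblst, st e = ⊥ ∧ pr e = ⊤ := by decide
  exact ⟨f e, by rw [← f.map_st, he, f.map_bot], by rw [← f.map_pr, he', f.map_top]⟩

theorem ThreeKlst.exists_middle {A : Type u} [DLAlgebra A] (f : Hom ThreeKlst A) :
    ∃ e : A, st e = ⊥ ∧ pr e = e := by
  obtain ⟨e, he, he'⟩ : ∃ e : ThreeKlst, st e = ⊥ ∧ pr e = e := by decide
  exact ⟨f e, by rw [← f.map_st, he, f.map_bot], by rw [← f.map_pr, he']⟩

theorem FourDmba.exists_atom {A : Type u} [DLAlgebra A] (f : Hom FourDmba A) :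
    ∃ c : A, st (st c) = c ∧ pr c = c := by
  obtain ⟨c, hc, hc'⟩ : ∃ c : FourDmba, st (st c) = c ∧ pr c = c := by decide
  exact ⟨f c, by rw [← f.map_st, ← f.map_st, hc], by rw [← f.map_pr, hc']⟩

/-! ### Failure of enough injectives -/

/-- The embedding of `Two` in `ThreeDblst`. -/
def Two.toThreeDblst : Hom Two ThreeDblst :=
  Hom.ofMap (fun x : Two => if x = ⊥ then (⊥ : ThreeDblst) else ⊤) (by decide) (by decide)
    (by decide) (by decide) (by decide) (by decide)

/-- The embedding of `Two` in `ThreeKlst`. -/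
def Two.toThreeKlst : Hom Two ThreeKlst :=
  Hom.ofMap (fun x : Two => if x = ⊥ then (⊥ : ThreeKlst) else ⊤) (by decide) (by decide)
    (by decide) (by decide) (by decide) (by decide)

/-- The embedding of `Two` in `FourDmba`. -/
def Two.toFourDmba : Hom Two FourDmba :=
  Hom.ofMap (fun x : Two => if x = ⊥ then (⊥ : FourDmba) else ⊤)
    (by decide) (by decide) (by decide) (by decide) (by decide) (by decide)

theorem Two.toThreeDblst_isEmbedding : Two.toThreeDblst.IsEmbedding :=
  (by decide : ∀ x y, Two.toThreeDblst x = Two.toThreeDblst y → x = y)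
theorem Two.toThreeKlst_isEmbedding : Two.toThreeKlst.IsEmbedding :=
  (by decide : ∀ x y, Two.toThreeKlst x = Two.toThreeKlst y → x = y)
theorem Two.toFourDmba_isEmbedding : Two.toFourDmba.IsEmbedding :=
  (by decide : ∀ x y, Two.toFourDmba x = Two.toFourDmba y → x = y)

/-- The homomorphism between copies in another universe. -/
def Hom.uLift {S : Type v} {T : Type w} [DLAlgebra S] [DLAlgebra T] (f : Hom S T) :
    Hom (ULift.{u} S) (ULift.{u} T) :=
  (Hom.up T).comp (f.comp (Hom.down S))

theorem Hom.IsEmbedding.uLift {S : Type v} {T : Type w} [DLAlgebra S] [DLAlgebra T] {f : Hom S T}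
    (hf : f.IsEmbedding) : (Hom.uLift.{u} f).IsEmbedding :=
  fun _ _ h => ULift.down_injective (hf (congrArg ULift.down h))

/-- Only the existence of the extension `T → J` matters, not its agreement on `R`: `collapse` needs
just the two homomorphisms into `J`. -/
theorem not_hasEnoughInjectives {C : AlgClass.{u}} {R S T : Type} [DLAlgebra R] [DLAlgebra S]
    [DLAlgebra T] (hR : C (ULift.{u} R)) (hS : C (ULift.{u} S)) (hT : C (ULift.{u} T))
    (i : Hom R S) (j : Hom R T) (hj : j.IsEmbedding) (hne : (⊥ : S) ≠ ⊤)
    (collapse : ∀ (J : Type u) [DLAlgebra J], C J → Hom S J → Hom T J → (⊥ : J) = ⊤) :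
    ¬ HasEnoughInjectives C := by
  intro H
  obtain ⟨J, _, ⟨hJ, inj⟩, m, hm⟩ := H (ULift.{u} S) hS
  obtain ⟨h, -⟩ := inj _ _ hR hT j.uLift (m.comp i.uLift) hj.uLift
  have := collapse J hJ (m.comp (Hom.up S)) (h.comp (Hom.up T))
  rw [← m.map_bot, ← m.map_top] at this
  exact hne (congrArg ULift.down (hm this))

theorem V₂_left (S T : Type) [DLAlgebra S] [DLAlgebra T] :
    V₂.{u} S T (ULift.{u} S) := varietyGenBy_of_mem (Or.inl (isoClass_uLift S))

theorem V₂_right (S T : Type) [DLAlgebra S] [DLAlgebra T] :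
    V₂.{u} S T (ULift.{u} T) := varietyGenBy_of_mem (Or.inr (isoClass_uLift T))

theorem varietyGenBy_sub {K : AlgClass.{u}} {A B : Type u} [DLAlgebra A] [DLAlgebra B]
    (f : Hom A B) (hf : f.IsEmbedding) (hB : varietyGenBy K B) : varietyGenBy K A :=
  fun C hC hK => hC.sub A B f hf (hB C hC hK)

theorem not_hasEnoughInjectives_G : ¬ HasEnoughInjectives G.{u} := by
  refine not_hasEnoughInjectives (isGautama_two.of_isEmbedding (Hom.down _) ULift.down_injective)
    (isGautama_threeDblst.of_isEmbedding (Hom.down _) ULift.down_injective)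
    (isGautama_threeKlst.of_isEmbedding (Hom.down _) ULift.down_injective)
    Two.toThreeDblst Two.toThreeKlst Two.toThreeKlst_isEmbedding (by decide)
    fun J _ hJ f g => ?_
  obtain ⟨e, he, he'⟩ := ThreeDblst.exists_middle f
  obtain ⟨k, hk, hk'⟩ := ThreeKlst.exists_middle g
  exact IsGautama.bot_eq_top_of_dense_of_fixed hJ he he' hk hk'

theorem IsAlmostGautama.bot_eq_top {J : Type u} [DLAlgebra J] (hJ : IsAlmostGautama J)
    (f : Hom ThreeDblst J) (g : Hom FourDmba J) : (⊥ : J) = ⊤ := by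
  obtain ⟨e, he, he'⟩ := ThreeDblst.exists_middle f
  obtain ⟨c, hc, hc'⟩ := FourDmba.exists_atom g
  exact hJ.bot_eq_top_of_dense_of_fixed he he' hc hc'

theorem not_hasEnoughInjectives_AG : ¬ HasEnoughInjectives AG.{u} := by
  have h3 := isAlmostGautama_threeDblst.of_isEmbedding (Hom.down.{u} _) ULift.down_injective
  exact not_hasEnoughInjectives
    (h3.of_isEmbedding Two.toThreeDblst.uLift Two.toThreeDblst_isEmbedding.uLift) h3
    (isAlmostGautama_fourDmba.of_isEmbedding (Hom.down _) ULift.down_injective)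
    Two.toThreeDblst Two.toFourDmba Two.toFourDmba_isEmbedding (by decide)
    fun J _ hJ f g => IsAlmostGautama.bot_eq_top hJ f g

theorem not_hasEnoughInjectives_V₂_threeDblst_fourDmba :
    ¬ HasEnoughInjectives (V₂.{u} ThreeDblst FourDmba) :=
  not_hasEnoughInjectives
    (varietyGenBy_sub Two.toThreeDblst.uLift Two.toThreeDblst_isEmbedding.uLift (V₂_left _ _))
    (V₂_left _ _) (V₂_right _ _) Two.toThreeDblst Two.toFourDmba Two.toFourDmba_isEmbedding
    (by decide) fun _ _ hJ f g => (AG_of_V₂_threeDblst_fourDmba hJ).bot_eq_top f g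

theorem not_hasEnoughInjectives_V₂_threeKlst_fourDmba :
    ¬ HasEnoughInjectives (V₂.{u} ThreeKlst FourDmba) := by
  refine not_hasEnoughInjectives
    (varietyGenBy_sub Two.toThreeKlst.uLift Two.toThreeKlst_isEmbedding.uLift (V₂_left _ _))
    (V₂_left _ _) (V₂_right _ _) Two.toThreeKlst Two.toFourDmba Two.toFourDmba_isEmbedding
    (by decide) fun J _ hJ f g => ?_
  obtain ⟨e, he, he'⟩ := ThreeKlst.exists_middle f
  obtain ⟨c, hc, hc'⟩ := FourDmba.exists_atom g
  obtain ⟨h, inv⟩ := involutiveAG_of_V₂_threeKlst_fourDmba hJ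
  exact h.bot_eq_top_of_involutive inv he he' hc hc'

end AlmostGautama

theorem mainTheorem3 :
    (AlmostGautama.HasEnoughInjectives (AlmostGautama.V.{u} AlmostGautama.Two) ∧
      AlmostGautama.HasEnoughInjectives (AlmostGautama.V.{u} AlmostGautama.ThreeDblst) ∧
      AlmostGautama.HasEnoughInjectives (AlmostGautama.V.{u} AlmostGautama.ThreeKlst) ∧
      AlmostGautama.HasEnoughInjectives (AlmostGautama.V.{u} AlmostGautama.FourDmba)) ∧
    (¬ AlmostGautama.HasEnoughInjectives AlmostGautama.G.{u} ∧
      ¬ AlmostGautama.HasEnoughInjectives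
        (AlmostGautama.V₂.{u} AlmostGautama.ThreeDblst AlmostGautama.FourDmba) ∧
      ¬ AlmostGautama.HasEnoughInjectives
        (AlmostGautama.V₂.{u} AlmostGautama.ThreeKlst AlmostGautama.FourDmba) ∧
      ¬ AlmostGautama.HasEnoughInjectives AlmostGautama.AG.{u}) := by
  open AlmostGautama in
  exact ⟨⟨hasEnoughInjectives_V neqDetects_two (kernelHomogeneous_of_small (by decide)),
      hasEnoughInjectives_V neqDetects_threeDblst (kernelHomogeneous_of_small (by decide)),
      hasEnoughInjectives_V neqDetects_threeKlst (kernelHomogeneous_of_small (by decide)),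
      hasEnoughInjectives_V neqDetects_fourDmba kernelHomogeneous_fourDmba⟩,
    not_hasEnoughInjectives_G, not_hasEnoughInjectives_V₂_threeDblst_fourDmba,
    not_hasEnoughInjectives_V₂_threeKlst_fourDmba, not_hasEnoughInjectives_AG⟩
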